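/- Let $n\ge 1$ and let $X_1,\dots,X_n$ be independent random vectors with common distribution $\mu$ on $\mathbb{R}^d$, and let $\mu_n:=\frac1n\sum_{i=1}^n\delta_{X_i}$ be their empirical measure. Let $\mathcal{A}$ be a non-empty class of Borel subsets of $\mathbb{R}^d$ that is pointwise measurable, i.e. there is an at most countable subclass $\mathcal{A}_0\subseteq\mathcal{A}$ such that for every $A\in\mathcal{A}$ there is a sequence $(A_k)_{k\in\mathbb{N}}$ in $\mathcal{A}_0$ with $\mathbf{1}_{A_k}(x)\to\mathbf{1}_A(x)$ for every $x\in\mathbb{R}^d$. Let $\mathbb{A}\subseteq\mathbb{R}^d$ be a Borel set that contains every $A\in\mathcal{A}$, and put $p:=\mu(\mathbb{A})$. For $m\in\mathbb{N}$ let $$S_{\mathcal{A}}(m):=\max_{x_1,\dots,x_m\in\mathbb{R}^d}\bigl|\bigl\{\{x_1,\dots,x_m\}\cap A : A\in\mathcal{A}\bigr\}\bigr|,$$ and let $V_{\mathcal{A}}:=\sup\{m\in\mathbb{N}: S_{\mathcal{A}}(m)=2^m\}$ be the VC dimension of $\mathcal{A}$. If $V_{\mathcal{A}}<+\infty$, then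 for every $\delta\in(0,1)$, with probability at least $1-\delta$, $$\sup_{A\in\mathcal{A}}|\mu_n(A)-\mu(A)|\le\frac{2}{3n}\log(1/\delta)+\sqrt{\frac{2p}{n}}\left(\sqrt{2\log(1/\delta)}+\sqrt{\log 2+V_{\mathcal{A}}\log(2np+1)}+\frac{\sqrt2}{2}\right).$$ -/

import Mathlib

open Filter Topology MeasureTheory ProbabilityTheory
open scoped ENNReal

noncomputable section

/-- The empirical measure `n⁻¹ ∑ᵢ δ_{xᵢ}` of the points `x₁, …, xₙ`. -/
def empiricalMeasure {α : Type*} [MeasurableSpace α] {n : ℕ} (x : Fin n → α) : Measure α :=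
  (n : ℝ≥0∞)⁻¹ • ∑ i, Measure.dirac (x i)

/-- The maximal deviation `sup_{A ∈ 𝒜} |μₙ(A) - μ(A)|` for the empirical measure `μₙ` of the
points `x₁, …, xₙ`. -/
def maxDeviation {α : Type*} [MeasurableSpace α] (μ : Measure α) (𝒜 : Set (Set α)) {n : ℕ}
    (x : Fin n → α) : ℝ :=
  ⨆ A : 𝒜, |(empiricalMeasure x).real (A : Set α) - μ.real (A : Set α)|

/-- The family of traces `{x₁, …, xₙ} ∩ A`, `A ∈ 𝒜`. -/
def traces {α : Type*} (𝒜 : Set (Set α)) {n : ℕ} (x : Fin n → α) : Set (Set α) :=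
  (fun A => Set.range x ∩ A) '' 𝒜

/-- The shattering coefficient: the maximum over `x₁, …, xₙ` of the number of traces
`{x₁, …, xₙ} ∩ A`, `A ∈ 𝒜`. -/
def shatterCoeff {α : Type*} (𝒜 : Set (Set α)) (n : ℕ) : ℕ :=
  ⨆ x : Fin n → α, (traces 𝒜 x).ncard

/-- The number of traces on `n` points is at most `2 ^ n`, so the supremum that defines
`shatterCoeff` is that of a bounded set of natural numbers. -/
theorem ncard_traces_le {α : Type*} (𝒜 : Set (Set α)) {n : ℕ} (x : Fin n → α) :
    (traces 𝒜 x).Finite ∧ (traces 𝒜 x).ncard ≤ 2 ^ n := by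
  have hsub : traces 𝒜 x ⊆ 𝒫 (Set.range x) := by
    rintro _ ⟨A, _, rfl⟩
    exact Set.inter_subset_left
  have hfin : (𝒫 (Set.range x)).Finite := (Set.finite_range x).finite_subsets
  refine ⟨hfin.subset hsub, (Set.ncard_le_ncard hsub hfin).trans ?_⟩
  rw [Set.ncard_powerset _ (Set.finite_range x)]
  refine Nat.pow_le_pow_right (by norm_num) ?_
  rw [← Set.image_univ]
  refine (Set.ncard_image_le Set.finite_univ).trans ?_
  simp [Set.ncard_univ]

/-- The Vapnik–Chervonenkis dimension `sup {n : shatterCoeff 𝒜 n = 2 ^ n}`, possibly infinite. -/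
def vcDimension {α : Type*} (𝒜 : Set (Set α)) : ℕ∞ :=
  ⨆ n ∈ {n : ℕ | shatterCoeff 𝒜 n = 2 ^ n}, (n : ℕ∞)

/-- Pointwise measurability: a countable subclass of `𝒜` is such that the indicator of every
`A ∈ 𝒜` is the pointwise limit of indicators of a sequence of sets of that subclass. -/
def PointwiseMeasurable {α : Type*} (𝒜 : Set (Set α)) : Prop :=
  ∃ 𝒜₀ : Set (Set α), 𝒜₀ ⊆ 𝒜 ∧ 𝒜₀.Countable ∧
    ∀ A ∈ 𝒜, ∃ B : ℕ → Set α, (∀ k, B k ∈ 𝒜₀) ∧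
      ∀ x, Tendsto (fun k => (B k).indicator (fun _ => (1 : ℝ)) x) atTop
        (𝓝 (A.indicator (fun _ => (1 : ℝ)) x))

end

/-! The maximal deviation is replaced by that over a countable subclass, where it is measurable, and
is then bounded by its mean plus a fluctuation. Write R for the Borel set containing the class and N
for the number of sample points in R.

Fluctuation: altering one sample point moves the supremum by at most 1/n, and not at all if the old
and new points both lie outside R. Each coordinate therefore contributes variance at most p/n², and
integrating out the coordinates one at a time yields a Bernstein bound (`measureReal_pi_bernstein`)
in which p appears.

Mean (`integral_maxDeviation_le`): the ghost sample is drawn from μ conditioned on R, not from μ.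
Averaging `crossDiff` over it recovers n(μₙ(A) - μ(A)) up to (N - np)μ(A|R), which costs √(np), the
source of the term √2/2. Exchanging a pair when both points lie in R preserves the law and flips the
sign of `crossDiff`, so random signs may be inserted. Only the N pairs with first point in R matter:
Sauer–Shelah leaves at most (2N+1)^V vectors, of squared norm at most N, and Massart's lemma
applies. With a nonrandom parameter l, and the logarithm replaced by its tangent at N = np, the
resulting bound is affine in N, so its mean needs only E N = np. -/

/-! ### Sauer–Shelah for the VC dimension. -/

/-- A class of sets that cuts out every subset of a finite set `t` has VC dimension at least
`t.card`. -/
theorem card_le_vcDimension_of_shatters {α : Type*} {𝒜 : Set (Set α)} {t : Finset α}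
    (h : ∀ u ⊆ t, ∃ A ∈ 𝒜, (t : Set α) ∩ A = u) : (t.card : ℕ∞) ≤ vcDimension 𝒜 := by
  have key : shatterCoeff 𝒜 t.card = 2 ^ t.card := by
    have hbdd : BddAbove (Set.range fun x : Fin t.card → α => (traces 𝒜 x).ncard) := by
      refine ⟨2 ^ t.card, ?_⟩
      rintro _ ⟨x, rfl⟩
      exact (ncard_traces_le 𝒜 x).2
    have : Nonempty (Fin t.card → α) := ⟨fun i => (t.equivFin.symm i : α)⟩
    refine le_antisymm (ciSup_le fun x => (ncard_traces_le 𝒜 x).2) ?_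
    refine le_trans ?_ (le_ciSup hbdd fun i => (t.equivFin.symm i : α))
    have hrange : Set.range (fun i => (t.equivFin.symm i : α)) = t := by
      ext a
      constructor
      · rintro ⟨i, rfl⟩
        exact (t.equivFin.symm i).2
      · intro ha
        exact ⟨t.equivFin ⟨a, ha⟩, by simp⟩
    have hsup : 𝒫 (t : Set α) ⊆ traces 𝒜 (fun i => (t.equivFin.symm i : α)) := by
      intro u hu
      have hfin : u.Finite := t.finite_toSet.subset hu
      obtain ⟨A, hA, hAu⟩ := h hfin.toFinset (by
        intro a ha
        exact hu (by simpa using ha))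
      exact ⟨A, hA, by simpa [hrange] using hAu⟩
    have := Set.ncard_le_ncard hsup (ncard_traces_le 𝒜 _).1
    rwa [Set.ncard_powerset _ t.finite_toSet, Set.ncard_coe_finset] at this
  exact le_iSup₂_of_le (f := fun n (_ : n ∈ {n : ℕ | shatterCoeff 𝒜 n = 2 ^ n}) => (n : ℕ∞))
    t.card key le_rfl

/-- Termwise comparison with the binomial expansion of (m + 1)^V, whose coefficients are at least 1.
-/
theorem sum_range_choose_le_pow (m V : ℕ) :
    ∑ i ∈ Finset.range (V + 1), m.choose i ≤ (m + 1) ^ V := by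
  rw [add_pow]
  refine Finset.sum_le_sum fun i hi => ?_
  have hi' : i ≤ V := Nat.lt_succ_iff.1 (Finset.mem_range.1 hi)
  have h1 : 1 ≤ V.choose i := Nat.choose_pos hi'
  have h2 : m.choose i ≤ m ^ i := Nat.choose_le_pow m i
  simp only [one_pow, mul_one, Nat.cast_id]
  nlinarith [Nat.zero_le (m ^ i)]

/-- The Sauer–Shelah lemma: a class of VC dimension `V` cuts out at most `(m + 1) ^ V` subsets of
a set of `m` points. -/
theorem ncard_inter_image_le_pow {α : Type*} {𝒜 : Set (Set α)} (hV : vcDimension 𝒜 < ⊤)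
    (s : Finset α) :
    ((fun A => (s : Set α) ∩ A) '' 𝒜).ncard ≤ (s.card + 1) ^ (vcDimension 𝒜).toNat := by
  classical
  set V := (vcDimension 𝒜).toNat with hVdef
  set 𝓑 : Finset (Finset α) := s.powerset.filter fun t => ∃ A ∈ 𝒜, (s : Set α) ∩ A = t with h𝓑
  have himage : (fun A => (s : Set α) ∩ A) '' 𝒜 = (fun t : Finset α => (t : Set α)) '' 𝓑 := by
    ext u
    constructor
    · rintro ⟨A, hA, rfl⟩
      have hfin : ((s : Set α) ∩ A).Finite := s.finite_toSet.inter_of_left A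
      refine ⟨hfin.toFinset, ?_, by simp⟩
      simp only [h𝓑, Finset.coe_filter, Finset.mem_powerset, Set.mem_ofPred_eq]
      refine ⟨fun a ha => ?_, A, hA, by simp⟩
      simp only [Set.Finite.mem_toFinset] at ha
      exact ha.1
    · rintro ⟨t, ht, rfl⟩
      simp only [h𝓑, Finset.coe_filter, Finset.mem_powerset, Set.mem_ofPred_eq] at ht
      obtain ⟨A, hA, h⟩ := ht.2
      exact ⟨A, hA, h⟩
  -- A shattered set lies in `s` and has at most V points. Pajor's inequality, that a family has no
  -- more members than it shatters sets, then reduces the bound to counting.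
  have hshat : 𝓑.shatterer ⊆ (Finset.range (V + 1)).biUnion fun i => s.powersetCard i := by
    intro t ht
    rw [Finset.mem_shatterer] at ht
    obtain ⟨b, hb, htb⟩ := ht.exists_superset
    have hts : t ⊆ s := htb.trans (Finset.mem_powerset.1 (Finset.mem_filter.1 hb).1)
    have hcard : (t.card : ℕ∞) ≤ vcDimension 𝒜 := by
      refine card_le_vcDimension_of_shatters fun u hu => ?_
      obtain ⟨b, hb, hbu⟩ := ht hu
      obtain ⟨A, hA, hAb⟩ := (Finset.mem_filter.1 hb).2
      refine ⟨A, hA, ?_⟩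
      rw [← hbu, Finset.coe_inter, ← hAb, ← Set.inter_assoc,
        Set.inter_eq_left.2 (Finset.coe_subset.2 hts)]
    have : t.card ≤ V := by
      have h := ENat.toNat_le_toNat hcard hV.ne
      simpa using h
    simp only [Finset.mem_biUnion, Finset.mem_range, Finset.mem_powersetCard]
    exact ⟨t.card, by omega, hts, rfl⟩
  calc ((fun A => (s : Set α) ∩ A) '' 𝒜).ncard ≤ 𝓑.card := by
        rw [himage, ← Set.ncard_coe_finset 𝓑]
        exact Set.ncard_image_le 𝓑.finite_toSet
    _ ≤ 𝓑.shatterer.card := Finset.card_le_card_shatterer 𝓑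
    _ ≤ ∑ i ∈ Finset.range (V + 1), (s.powersetCard i).card :=
        (Finset.card_le_card hshat).trans Finset.card_biUnion_le
    _ = ∑ i ∈ Finset.range (V + 1), s.card.choose i := by simp
    _ ≤ (s.card + 1) ^ V := sum_range_choose_le_pow _ _

/-! ### Empirical measures and reduction to a countable class. -/

theorem empiricalMeasure_real {α : Type*} [MeasurableSpace α] {n : ℕ} (x : Fin n → α)
    {A : Set α} (hA : MeasurableSet A) :
    (empiricalMeasure x).real A = (n : ℝ)⁻¹ * ∑ i, A.indicator (fun _ => (1 : ℝ)) (x i) := by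
  rw [empiricalMeasure, Measure.real, Measure.smul_apply, smul_eq_mul, ENNReal.toReal_mul,
    ENNReal.toReal_inv, ENNReal.toReal_natCast, Measure.finsetSum_apply, ENNReal.toReal_sum]
  · congr 1
    refine Finset.sum_congr rfl fun i _ => ?_
    rw [Measure.dirac_apply' _ hA]
    by_cases h : x i ∈ A <;> simp [h]
  · intro i _
    rw [Measure.dirac_apply' _ hA]
    by_cases h : x i ∈ A <;> simp [h]

instance isFiniteMeasure_empiricalMeasure {α : Type*} [MeasurableSpace α] {n : ℕ} (x : Fin n → α) :
    IsFiniteMeasure (empiricalMeasure x) := by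
  refine ⟨?_⟩
  rw [empiricalMeasure, Measure.smul_apply, smul_eq_mul, Measure.finsetSum_apply]
  rcases Nat.eq_zero_or_pos n with rfl | hn
  · simp
  · refine ENNReal.mul_lt_top ?_ ?_
    · simp [hn]
    · simp

theorem empiricalMeasure_real_le_one {α : Type*} [MeasurableSpace α] {n : ℕ} (x : Fin n → α)
    (A : Set α) : (empiricalMeasure x).real A ≤ 1 := by
  refine (measureReal_mono (Set.subset_univ A)).trans ?_
  rw [empiricalMeasure_real x MeasurableSet.univ]
  rcases Nat.eq_zero_or_pos n with rfl | hn
  · simp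
  · have : (n : ℝ) ≠ 0 := by positivity
    simp [this]

theorem abs_empiricalMeasure_sub_le_one {α : Type*} [MeasurableSpace α] (μ : Measure α)
    [IsProbabilityMeasure μ] {n : ℕ} (x : Fin n → α) (A : Set α) :
    |(empiricalMeasure x).real A - μ.real A| ≤ 1 := by
  have h1 := empiricalMeasure_real_le_one x A
  have h2 : μ.real A ≤ 1 := measureReal_le_one
  have h3 : 0 ≤ (empiricalMeasure x).real A := measureReal_nonneg
  have h4 : 0 ≤ μ.real A := measureReal_nonneg
  rw [abs_le]
  constructor <;> linarith

theorem bddAbove_deviation {α : Type*} [MeasurableSpace α] (μ : Measure α)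
    [IsProbabilityMeasure μ] (𝒜 : Set (Set α)) {n : ℕ} (x : Fin n → α) :
    BddAbove (Set.range fun A : 𝒜 => |(empiricalMeasure x).real (A : Set α) - μ.real A|) :=
  ⟨1, by rintro _ ⟨A, rfl⟩; exact abs_empiricalMeasure_sub_le_one μ x A⟩

theorem tendsto_measureReal_of_tendsto_indicator {α : Type*} [MeasurableSpace α] (μ : Measure α)
    [IsFiniteMeasure μ] {A : Set α} {B : ℕ → Set α} (hA : MeasurableSet A)
    (hB : ∀ k, MeasurableSet (B k))
    (h : ∀ x, Tendsto (fun k => (B k).indicator (fun _ => (1 : ℝ)) x) atTop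
        (𝓝 (A.indicator (fun _ => (1 : ℝ)) x))) :
    Tendsto (fun k => μ.real (B k)) atTop (𝓝 (μ.real A)) := by
  have key := tendsto_integral_of_dominated_convergence (μ := μ) (fun _ => (1 : ℝ))
    (F := fun k => (B k).indicator (fun _ => (1 : ℝ)))
    (f := A.indicator (fun _ => (1 : ℝ)))
    (fun k => (measurable_const.indicator (hB k)).aestronglyMeasurable)
    (integrable_const _)
    (fun k => ae_of_all _ fun x => by
      by_cases hx : x ∈ B k <;> simp [hx])
    (ae_of_all _ h)
  simpa [integral_indicator, hA, hB] using key

/-- The maximal deviation over a pointwise measurable class equals that over the countable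
subclass. -/
theorem maxDeviation_eq_of_subclass {α : Type*} [MeasurableSpace α] (μ : Measure α)
    [IsProbabilityMeasure μ] {𝒜 𝒜₀ : Set (Set α)} (hne : 𝒜.Nonempty)
    (hmeas : ∀ A ∈ 𝒜, MeasurableSet A) (hsub : 𝒜₀ ⊆ 𝒜)
    (happrox : ∀ A ∈ 𝒜, ∃ B : ℕ → Set α, (∀ k, B k ∈ 𝒜₀) ∧
      ∀ x, Tendsto (fun k => (B k).indicator (fun _ => (1 : ℝ)) x) atTop
        (𝓝 (A.indicator (fun _ => (1 : ℝ)) x))) {n : ℕ} (x : Fin n → α) :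
    maxDeviation μ 𝒜 x = maxDeviation μ 𝒜₀ x := by
  have : Nonempty 𝒜 := hne.to_subtype
  have : Nonempty 𝒜₀ := by
    obtain ⟨A, hA⟩ := hne
    obtain ⟨B, hB, -⟩ := happrox A hA
    exact ⟨⟨B 0, hB 0⟩⟩
  refine le_antisymm (ciSup_le ?_) (ciSup_le ?_)
  · rintro ⟨A, hA⟩
    obtain ⟨B, hB, hlim⟩ := happrox A hA
    have hBm : ∀ k, MeasurableSet (B k) := fun k => hmeas _ (hsub (hB k))
    have ht := ((tendsto_measureReal_of_tendsto_indicator (empiricalMeasure x) (hmeas A hA) hBm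
      hlim).sub (tendsto_measureReal_of_tendsto_indicator μ (hmeas A hA) hBm hlim)).abs
    refine le_of_tendsto ht (Eventually.of_forall fun k => ?_)
    exact le_ciSup (bddAbove_deviation μ 𝒜₀ x) ⟨B k, hB k⟩
  · rintro ⟨A, hA⟩
    exact le_ciSup (bddAbove_deviation μ 𝒜 x) ⟨A, hsub hA⟩

theorem measurable_maxDeviation {α : Type*} [MeasurableSpace α] (μ : Measure α)
    {𝒜 : Set (Set α)} (hc : 𝒜.Countable) (hmeas : ∀ A ∈ 𝒜, MeasurableSet A) (n : ℕ) :
    Measurable fun x : Fin n → α => maxDeviation μ 𝒜 x := by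
  have : Countable 𝒜 := hc.to_subtype
  refine Measurable.iSup fun A => ?_
  simp_rw [empiricalMeasure_real _ (hmeas A A.2)]
  have hm : Measurable ((A : Set α).indicator fun _ => (1 : ℝ)) :=
    measurable_const.indicator (hmeas A A.2)
  fun_prop

/-! ### Bernstein concentration for functions of independent variables. -/

theorem two_mul_three_pow_le_factorial (k : ℕ) : 2 * 3 ^ k ≤ (k + 2).factorial := by
  induction k with
  | zero => simp [Nat.factorial]
  | succ k ih =>
    rw [show k + 1 + 2 = (k + 2) + 1 by ring, Nat.factorial_succ, pow_succ]
    nlinarith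

/-- The inequality behind Bernstein's bound for the exponential moments of a bounded centred
random variable. -/
theorem exp_le_one_add_add_sq_div {u a : ℝ} (hu : |u| ≤ a) (ha : a < 3) :
    Real.exp u ≤ 1 + u + u ^ 2 / (2 * (1 - a / 3)) := by
  have ha0 : 0 ≤ a := (abs_nonneg u).trans hu
  have hexp : HasSum (fun k : ℕ => u ^ k / k.factorial) (Real.exp u) := by
    rw [Real.exp_eq_exp_ℝ]
    exact NormedSpace.expSeries_div_hasSum_exp u
  have hexp2 := (hasSum_nat_add_iff' (f := fun k : ℕ => u ^ k / k.factorial) 2).2 hexp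
  have hgeo := (hasSum_geometric_of_lt_one (r := a / 3) (by positivity) (by linarith)).mul_left
    (u ^ 2 / 2)
  -- The exponential series from its quadratic term on is dominated termwise by a geometric series
  -- of ratio a/3, since (k+2)! ≥ 2·3^k.
  have hle := hasSum_le (fun k => ?_) hexp2 hgeo
  · simp only [Finset.sum_range_succ, Finset.sum_range_zero] at hle
    norm_num at hle
    have : u ^ 2 / (2 * (1 - a / 3)) = u ^ 2 / 2 * (1 - a / 3)⁻¹ := by
      rw [div_mul_eq_div_div, div_eq_mul_inv (u ^ 2 / 2)]
    linarith
  · have hf : (2 : ℝ) * 3 ^ k ≤ ((k + 2).factorial : ℝ) := by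
      exact_mod_cast two_mul_three_pow_le_factorial k
    calc u ^ (k + 2) / ((k + 2).factorial : ℝ) ≤ |u| ^ (k + 2) / ((k + 2).factorial : ℝ) := by
          refine div_le_div_of_nonneg_right ?_ (by positivity)
          rw [← abs_pow]
          exact le_abs_self _
      _ ≤ |u| ^ (k + 2) / (2 * 3 ^ k) := by gcongr
      _ = u ^ 2 / 2 * (|u| / 3) ^ k := by
          rw [pow_add, sq_abs, div_pow]
          field_simp
      _ ≤ u ^ 2 / 2 * (a / 3) ^ k := by gcongr

theorem integrable_of_measurable_of_bound {α : Type*} [MeasurableSpace α] {μ : Measure α}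
    [IsFiniteMeasure μ] {f : α → ℝ} (hf : Measurable f) {C : ℝ} (hC : ∀ x, |f x| ≤ C) :
    Integrable f μ :=
  Integrable.of_bound hf.aestronglyMeasurable C (ae_of_all _ hC)

theorem abs_integral_le_of_bound {α : Type*} [MeasurableSpace α] {μ : Measure α}
    [IsProbabilityMeasure μ] {f : α → ℝ} {C : ℝ} (hC : ∀ x, |f x| ≤ C) :
    |∫ x, f x ∂μ| ≤ C := by
  simpa using norm_integral_le_of_norm_le_const (μ := μ) (f := f) (ae_of_all _ hC)

/-- A bounded function that oscillates by at most `c`, and is constant outside of `R`, has variance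
at most `c ^ 2 * μ R`. -/
theorem integral_sub_mean_sq_le {α : Type*} [MeasurableSpace α] (μ : Measure α)
    [IsProbabilityMeasure μ] {R : Set α} (hR : MeasurableSet R) {g : α → ℝ} (hg : Measurable g)
    {C c : ℝ} (hC : ∀ x, |g x| ≤ C) (hosc : ∀ x y, |g x - g y| ≤ c)
    (hconst : ∀ x y, x ∉ R → y ∉ R → g x = g y) :
    ∫ x, (g x - ∫ y, g y ∂μ) ^ 2 ∂μ ≤ c ^ 2 * μ.real R := by
  have hc : ∀ x, |g x - ∫ y, g y ∂μ| ≤ c := by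
    intro x
    have : g x - ∫ y, g y ∂μ = ∫ y, (g x - g y) ∂μ := by
      rw [integral_sub (integrable_const _) (integrable_of_measurable_of_bound hg hC)]
      simp
    rw [this]
    exact abs_integral_le_of_bound (hosc x)
  -- The variance is at most the second moment about any centre. The common value of `g` off R is
  -- the natural one, as only R then contributes; if R is everything, the mean serves.
  obtain ⟨a, ha⟩ : ∃ a, ∀ x, (g x - a) ^ 2 ≤ R.indicator (fun _ => c ^ 2) x := by
    by_cases h : ∃ y, y ∉ R
    · obtain ⟨y, hy⟩ := h
      refine ⟨g y, fun x => ?_⟩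
      by_cases hx : x ∈ R
      · simpa [hx] using sq_le_sq' (abs_le.1 (hosc x y)).1 (abs_le.1 (hosc x y)).2
      · simp [hx, hconst x y hx hy]
    · push Not at h
      refine ⟨∫ y, g y ∂μ, fun x => ?_⟩
      simpa [h x] using sq_le_sq' (abs_le.1 (hc x)).1 (abs_le.1 (hc x)).2
  calc ∫ x, (g x - ∫ y, g y ∂μ) ^ 2 ∂μ = Var[fun x => g x - a; μ] := by
        rw [variance_sub_const hg.aestronglyMeasurable, variance_eq_integral hg.aemeasurable]
    _ ≤ ∫ x, (g x - a) ^ 2 ∂μ :=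
        variance_le_expectation_sq (hg.sub_const a).aestronglyMeasurable
    _ ≤ ∫ x, R.indicator (fun _ => c ^ 2) x ∂μ :=
        integral_mono_of_nonneg (ae_of_all _ fun x => sq_nonneg _)
          ((integrable_const _).indicator hR) (ae_of_all _ ha)
    _ = c ^ 2 * μ.real R := by
        rw [integral_indicator hR]
        simp [mul_comm]

/-- In the pointwise quadratic bound for the exponential the linear term has mean zero and the
quadratic one is controlled by the variance; 1 + u ≤ exp u finishes. -/
theorem integral_exp_sub_mean_le {α : Type*} [MeasurableSpace α] (μ : Measure α)
    [IsProbabilityMeasure μ] {R : Set α} (hR : MeasurableSet R) {g : α → ℝ} (hg : Measurable g)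
    {C c l : ℝ} (hC : ∀ x, |g x| ≤ C) (hosc : ∀ x y, |g x - g y| ≤ c)
    (hconst : ∀ x y, x ∉ R → y ∉ R → g x = g y) (hl : 0 ≤ l) (hlc : l * c < 3) :
    ∫ x, Real.exp (l * (g x - ∫ y, g y ∂μ)) ∂μ ≤
      Real.exp (l ^ 2 * c ^ 2 * μ.real R / (2 * (1 - l * c / 3))) := by
  set m := ∫ y, g y ∂μ with hm
  have hgi : Integrable g μ := integrable_of_measurable_of_bound hg hC
  have hc : ∀ x, |g x - m| ≤ c := by
    intro x
    have : g x - m = ∫ y, (g x - g y) ∂μ := by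
      rw [integral_sub (integrable_const _) hgi]
      simp [hm]
    rw [this]
    exact abs_integral_le_of_bound (hosc x)
  have hpt : ∀ x, Real.exp (l * (g x - m)) ≤
      1 + l * (g x - m) + (l ^ 2 / (2 * (1 - l * c / 3))) * (g x - m) ^ 2 := by
    intro x
    have h : |l * (g x - m)| ≤ l * c := by
      rw [abs_mul, abs_of_nonneg hl]
      exact mul_le_mul_of_nonneg_left (hc x) hl
    refine (exp_le_one_add_add_sq_div h hlc).trans_eq ?_
    ring
  have hdi : Integrable (fun x => g x - m) μ := hgi.sub (integrable_const _)
  have hsq : Integrable (fun x => (g x - m) ^ 2) μ := by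
    refine integrable_of_measurable_of_bound (by fun_prop) (C := c ^ 2) fun x => ?_
    rw [abs_of_nonneg (sq_nonneg _)]
    exact sq_le_sq' (abs_le.1 (hc x)).1 (abs_le.1 (hc x)).2
  have hpos : 0 < 2 * (1 - l * c / 3) := by linarith
  have hi1 : Integrable (fun x => 1 + l * (g x - m)) μ :=
    (integrable_const _).add (hdi.const_mul l)
  have hi2 : Integrable (fun x => (l ^ 2 / (2 * (1 - l * c / 3))) * (g x - m) ^ 2) μ :=
    hsq.const_mul _
  calc ∫ x, Real.exp (l * (g x - m)) ∂μ
      ≤ ∫ x, (1 + l * (g x - m) + (l ^ 2 / (2 * (1 - l * c / 3))) * (g x - m) ^ 2) ∂μ :=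
        integral_mono_of_nonneg (ae_of_all _ fun x => (Real.exp_pos _).le) (hi1.add hi2)
          (ae_of_all _ hpt)
    _ = 1 + (l ^ 2 / (2 * (1 - l * c / 3))) * ∫ x, (g x - m) ^ 2 ∂μ := by
        rw [integral_add hi1 hi2, integral_add (integrable_const _) (hdi.const_mul l),
          integral_const_mul, integral_const_mul, integral_sub hgi (integrable_const _)]
        simp [hm]
    _ ≤ 1 + (l ^ 2 / (2 * (1 - l * c / 3))) * (c ^ 2 * μ.real R) := by
        gcongr
        exact integral_sub_mean_sq_le μ hR hg hC hosc hconst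
    _ ≤ Real.exp (l ^ 2 * c ^ 2 * μ.real R / (2 * (1 - l * c / 3))) := by
        refine le_trans (le_of_eq ?_) (Real.add_one_le_exp _)
        ring

theorem measurable_fin_cons {α : Type*} [MeasurableSpace α] (n : ℕ) :
    Measurable fun z : α × (Fin n → α) => (Fin.cons z.1 z.2 : Fin (n + 1) → α) := by
  refine measurable_pi_iff.2 fun i => ?_
  refine Fin.cases ?_ (fun j => ?_) i
  · simpa using measurable_fst
  · simpa [Function.comp_def] using (measurable_pi_apply j).comp measurable_snd

theorem integral_pi_fin_succ {α : Type*} [MeasurableSpace α] (μ : Measure α)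
    [IsProbabilityMeasure μ] {n : ℕ} {f : (Fin (n + 1) → α) → ℝ} (hf : Measurable f) {C : ℝ}
    (hC : ∀ x, |f x| ≤ C) :
    ∫ x, f x ∂(Measure.pi fun _ => μ) =
      ∫ y, ∫ x, f (Fin.cons x y) ∂μ ∂(Measure.pi fun _ : Fin n => μ) := by
  have h := (measurePreserving_piFinSuccAbove (fun _ : Fin (n + 1) => μ) 0).symm
  rw [← h.integral_comp']
  have hint : Integrable (fun z : α × (Fin n → α) => f (Fin.cons z.1 z.2))
      (μ.prod (Measure.pi fun _ : Fin n => μ)) :=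
    integrable_of_measurable_of_bound (hf.comp (measurable_fin_cons n)) (C := C)
      fun z => hC _
  rw [← integral_prod_symm _ hint]
  simp [MeasurableEquiv.piFinSuccAbove_symm_apply, Fin.insertNthEquiv]

/-- A Bernstein type bound for the exponential moments of a function of independent variables, each
of which changes the function by at most `c`, and does so only if its value is or was in `R`. -/
theorem integral_exp_sub_mean_pi_le {α : Type*} [MeasurableSpace α] (μ : Measure α)
    [IsProbabilityMeasure μ] {R : Set α} (hR : MeasurableSet R) {c l : ℝ} (hl : 0 ≤ l)
    (hlc : l * c < 3) {C : ℝ} (n : ℕ) {f : (Fin n → α) → ℝ} (hf : Measurable f)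
    (hC : ∀ x, |f x| ≤ C) (hosc : ∀ x i a, |f (Function.update x i a) - f x| ≤ c)
    (hconst : ∀ x i a, a ∉ R → x i ∉ R → f (Function.update x i a) = f x) :
    ∫ x, Real.exp (l * (f x - ∫ y, f y ∂(Measure.pi fun _ => μ))) ∂(Measure.pi fun _ => μ) ≤
      Real.exp (n * (l ^ 2 * c ^ 2 * μ.real R / (2 * (1 - l * c / 3)))) := by
  induction n with
  | zero =>
    have : ∀ x, f x = f default := fun x => congrArg f (Subsingleton.elim _ _)
    simp [this]
  | succ n ih =>
    set E := ∫ y, f y ∂(Measure.pi fun _ => μ) with hE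
    set B := l ^ 2 * c ^ 2 * μ.real R / (2 * (1 - l * c / 3)) with hB
    -- Averaging over the first coordinate keeps the oscillation bound and the insensitivity outside
    -- R, so the induction hypothesis applies to `F`.
    set F : (Fin n → α) → ℝ := fun y => ∫ x, f (Fin.cons x y) ∂μ with hF
    have hfm : Measurable fun z : (Fin n → α) × α => f (Fin.cons z.2 z.1) :=
      hf.comp ((measurable_fin_cons n).comp measurable_swap)
    have hfy : ∀ y : Fin n → α, Measurable fun x : α => f (Fin.cons x y) := fun y =>
      hfm.comp measurable_prodMk_left
    have hint : ∀ y : Fin n → α, Integrable (fun x : α => f (Fin.cons x y)) μ := fun y =>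
      integrable_of_measurable_of_bound (hfy y) fun x => hC _
    have hFm : Measurable F :=
      (hfm.stronglyMeasurable.integral_prod_right' (ν := μ)).measurable
    have hFC : ∀ y, |F y| ≤ C := fun y => abs_integral_le_of_bound fun x => hC _
    have hEF : E = ∫ y, F y ∂(Measure.pi fun _ : Fin n => μ) := integral_pi_fin_succ μ hf hC
    have hFosc : ∀ y i a, |F (Function.update y i a) - F y| ≤ c := by
      intro y i a
      rw [hF, ← integral_sub (hint _) (hint _)]
      refine abs_integral_le_of_bound fun x => ?_
      rw [Fin.cons_update]
      exact hosc _ _ _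
    have hFconst : ∀ y i a, a ∉ R → y i ∉ R → F (Function.update y i a) = F y := by
      intro y i a ha hy
      refine integral_congr_ae (ae_of_all _ fun x => ?_)
      change f (Fin.cons x (Function.update y i a)) = f (Fin.cons x y)
      rw [Fin.cons_update]
      exact hconst _ _ _ ha (by simpa using hy)
    have hbound : ∀ x, |Real.exp (l * (f x - E))| ≤ Real.exp (l * (C + |E|)) := by
      intro x
      rw [abs_of_pos (Real.exp_pos _)]
      gcongr
      have := (le_abs_self _).trans (hC x)
      have := neg_abs_le E
      linarith
    have hboundF : ∀ y, |Real.exp (l * (F y - E))| ≤ Real.exp (l * (C + |E|)) := by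
      intro x
      rw [abs_of_pos (Real.exp_pos _)]
      gcongr
      have := (le_abs_self _).trans (hFC x)
      have := neg_abs_le E
      linarith
    have hinner : ∀ y, ∫ x, Real.exp (l * (f (Fin.cons x y) - E)) ∂μ ≤
        Real.exp B * Real.exp (l * (F y - E)) := by
      intro y
      -- Martingale splitting f - E = (f - F) + (F - E): for fixed `y` only the first part varies
      -- with `x`, and it is centred.
      have h1 : ∀ x, Real.exp (l * (f (Fin.cons x y) - E)) =
          Real.exp (l * (f (Fin.cons x y) - F y)) * Real.exp (l * (F y - E)) := by
        intro x
        rw [← Real.exp_add]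
        ring_nf
      simp_rw [h1]
      rw [integral_mul_const]
      gcongr
      refine integral_exp_sub_mean_le μ hR (hfy y) (fun x => hC _) (fun a b => ?_)
        (fun a b ha hb => ?_) hl hlc
      · simpa using hosc (Fin.cons b y) 0 a
      · simpa using hconst (Fin.cons b y) 0 a ha (by simpa using hb)
    rw [integral_pi_fin_succ μ (by fun_prop) hbound]
    calc ∫ y, ∫ x, Real.exp (l * (f (Fin.cons x y) - E)) ∂μ ∂(Measure.pi fun _ : Fin n => μ)
        ≤ ∫ y, Real.exp B * Real.exp (l * (F y - E)) ∂(Measure.pi fun _ : Fin n => μ) := by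
          refine integral_mono_of_nonneg (ae_of_all _ fun y => ?_) ?_ (ae_of_all _ hinner)
          · exact integral_nonneg fun x => (Real.exp_pos _).le
          · exact (integrable_of_measurable_of_bound (by fun_prop) hboundF).const_mul _
      _ = Real.exp B * ∫ y, Real.exp (l * (F y - E)) ∂(Measure.pi fun _ : Fin n => μ) :=
          integral_const_mul _ _
      _ ≤ Real.exp B * Real.exp (n * B) := by
          gcongr
          rw [hEF]
          exact ih hFm hFC hFosc hFconst
      _ = Real.exp ((n + 1 : ℕ) * B) := by
          rw [← Real.exp_add]
          push_cast
          ring_nf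

/-- A Bernstein type concentration inequality for functions of independent variables. -/
theorem measureReal_pi_bernstein {α : Type*} [MeasurableSpace α] (μ : Measure α)
    [IsProbabilityMeasure μ] {R : Set α} (hR : MeasurableSet R) (hRpos : 0 < μ.real R) {c : ℝ}
    (hc : 0 < c) {C : ℝ} {n : ℕ} (hn : 0 < n) {f : (Fin n → α) → ℝ} (hf : Measurable f)
    (hC : ∀ x, |f x| ≤ C) (hosc : ∀ x i a, |f (Function.update x i a) - f x| ≤ c)
    (hconst : ∀ x i a, a ∉ R → x i ∉ R → f (Function.update x i a) = f x) {L : ℝ} (hL : 0 < L) :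
    (Measure.pi fun _ => μ).real {x | ∫ y, f y ∂(Measure.pi fun _ => μ) +
      (2 / 3 * c * L + Real.sqrt (2 * (n * c ^ 2 * μ.real R) * L)) ≤ f x} ≤ Real.exp (-L) := by
  set E := ∫ y, f y ∂(Measure.pi fun _ => μ) with hE
  set s := n * c ^ 2 * μ.real R with hs
  have hspos : 0 < s := by positivity
  set q := Real.sqrt (2 * s * L) with hq
  have hq2 : q ^ 2 = 2 * s * L := Real.sq_sqrt (by positivity)
  have hq0 : 0 ≤ q := Real.sqrt_nonneg _
  set t := 2 / 3 * c * L + q with ht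
  have htpos : 0 < t := by positivity
  have hden : 0 < s + c * t / 3 := by positivity
  -- The usual Bernstein parameter; it makes the exponent exactly -t²/(2(s + ct/3)).
  set l := t / (s + c * t / 3) with hl
  have hl0 : 0 ≤ l := by positivity
  have h1 : 1 - l * c / 3 = s / (s + c * t / 3) := by
    rw [hl]
    field_simp
    ring
  have hlc : l * c < 3 := by
    have : 0 < 1 - l * c / 3 := by
      rw [h1]
      positivity
    linarith
  have hint : Integrable (fun x => Real.exp (l * (f x - E))) (Measure.pi fun _ => μ) := by
    refine integrable_of_measurable_of_bound (by fun_prop) (C := Real.exp (l * (C + |E|)))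
      fun x => ?_
    rw [abs_of_pos (Real.exp_pos _)]
    gcongr
    have := (le_abs_self _).trans (hC x)
    have := neg_abs_le E
    linarith
  have hset : {x | E + t ≤ f x} = {x | t ≤ f x - E} := by
    ext x
    simp only [Set.mem_ofPred_eq]
    constructor <;> intro h <;> linarith
  rw [hset]
  refine (measure_ge_le_exp_mul_mgf t hl0 hint).trans ?_
  have hmgf := integral_exp_sub_mean_pi_le μ hR hl0 hlc n hf hC hosc hconst
  rw [mgf]
  refine (mul_le_mul_of_nonneg_left hmgf (Real.exp_pos _).le).trans ?_
  rw [← Real.exp_add]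
  gcongr
  have h2 : -l * t + n * (l ^ 2 * c ^ 2 * μ.real R / (2 * (1 - l * c / 3))) =
      -(t ^ 2 / (2 * (s + c * t / 3))) := by
    have : n * (l ^ 2 * c ^ 2 * μ.real R / (2 * (1 - l * c / 3))) =
        l ^ 2 * s / (2 * (1 - l * c / 3)) := by
      rw [hs]
      ring
    rw [this, h1, hl]
    field_simp
    ring
  rw [h2, neg_le_neg_iff, le_div_iff₀ (by positivity)]
  -- Since t = 2cL/3 + q and q² = 2sL, the difference t² - 2L(s + ct/3) equals 2cLq/3 ≥ 0.
  nlinarith [mul_nonneg (mul_nonneg hc.le hL.le) hq0]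

/-! ### Rademacher averages over finitely many vectors. -/

/-- The sum over signs factorises into terms 2 cosh(l tᵢ), and cosh u ≤ exp(u²/2). -/
theorem sum_sign_exp_le {n : ℕ} (t : Fin n → ℝ) (l : ℝ) :
    ∑ e : Fin n → Bool, Real.exp (l * ∑ i, (if e i then 1 else -1) * t i) ≤
      2 ^ n * Real.exp (l ^ 2 * (∑ i, t i ^ 2) / 2) := by
  have h1 : ∀ e : Fin n → Bool, Real.exp (l * ∑ i, (if e i then 1 else -1) * t i) =
      ∏ i, (fun i (b : Bool) => Real.exp (l * ((if b then 1 else -1) * t i))) i (e i) := by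
    intro e
    rw [Finset.mul_sum, Real.exp_sum]
  have h2 := Finset.prod_univ_sum (fun _ : Fin n => (Finset.univ : Finset Bool))
    (fun i (b : Bool) => Real.exp (l * ((if b then 1 else -1) * t i)))
  rw [Fintype.piFinset_univ] at h2
  simp_rw [h1]
  rw [← h2]
  calc ∏ i, ∑ b : Bool, Real.exp (l * ((if b then 1 else -1) * t i))
      ≤ ∏ i, 2 * Real.exp ((l * t i) ^ 2 / 2) := by
        refine Finset.prod_le_prod (fun i _ => Finset.sum_nonneg fun b _ => (Real.exp_pos _).le)
          fun i _ => ?_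
        have := Real.cosh_le_exp_half_sq (l * t i)
        rw [Real.cosh_eq] at this
        simp only [Fintype.sum_bool, if_true, Bool.false_eq_true, if_false, one_mul, neg_mul,
          mul_neg]
        linarith
    _ = 2 ^ n * Real.exp (l ^ 2 * (∑ i, t i ^ 2) / 2) := by
        rw [Finset.prod_mul_distrib, Finset.prod_const, Finset.card_univ, Fintype.card_fin,
          ← Real.exp_sum, Finset.mul_sum, Finset.sum_div]
        simp_rw [mul_pow]

/-- Massart's finite class lemma, for Rademacher averages of at most `N` vectors. -/
theorem sum_sign_iSup_abs_le {ι : Type*} [Nonempty ι] {n : ℕ} (h : ι → Fin n → ℝ)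
    (hfin : (Set.range h).Finite) {N k l : ℝ} (hN : 1 ≤ N) (hcard : (Set.range h).ncard ≤ N)
    (hk : ∀ j, ∑ i, h j i ^ 2 ≤ k) (hl : 0 < l) :
    ∑ e : Fin n → Bool, ⨆ j, |∑ i, (if e i then 1 else -1) * h j i| ≤
      2 ^ n * (Real.log (2 * N) / l + l * k / 2) := by
  classical
  set T := hfin.toFinset with hT
  have hTcard : (T.card : ℝ) ≤ N := by
    rwa [hT, ← Set.ncard_eq_toFinset_card _ hfin]
  have hTk : ∀ t ∈ T, ∑ i, t i ^ 2 ≤ k := by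
    intro t ht
    obtain ⟨j, rfl⟩ := hfin.mem_toFinset.1 ht
    exact hk j
  set M := 2 * N * Real.exp (l ^ 2 * k / 2) with hM
  have hMpos : 0 < M := by positivity
  set s : (Fin n → Bool) → (Fin n → ℝ) → ℝ := fun e t => ∑ i, (if e i then 1 else -1) * t i
    with hs
  -- `M` bounds the sign average of the sum of exponentials. Bounding the logarithm by its tangent
  -- at `M` replaces Jensen's inequality, and the correction averages to at most zero.
  set Q : (Fin n → Bool) → ℝ := fun e =>
    (Real.log M + (∑ t ∈ T, (Real.exp (l * s e t) + Real.exp (-l * s e t))) / M - 1) / l with hQ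
  have hpt : ∀ e, ⨆ j, |∑ i, (if e i then 1 else -1) * h j i| ≤ Q e := by
    intro e
    refine ciSup_le fun j => ?_
    have hj : h j ∈ T := hfin.mem_toFinset.2 ⟨j, rfl⟩
    rw [hQ, le_div_iff₀ hl]
    have h1 : Real.exp (l * |s e (h j)|) ≤
        ∑ t ∈ T, (Real.exp (l * s e t) + Real.exp (-l * s e t)) := by
      refine le_trans ?_ (Finset.single_le_sum
        (f := fun t => Real.exp (l * s e t) + Real.exp (-l * s e t))
        (fun t _ => by positivity) hj)
      rcases abs_cases (s e (h j)) with ⟨ha, -⟩ | ⟨ha, -⟩ <;> rw [ha]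
      · linarith [Real.exp_pos (-l * s e (h j))]
      · rw [mul_neg, ← neg_mul]
        linarith [Real.exp_pos (l * s e (h j))]
    have h2 := Real.add_one_le_exp (l * |s e (h j)| - Real.log M)
    rw [Real.exp_sub, Real.exp_log hMpos] at h2
    have h3 := div_le_div_of_nonneg_right h1 hMpos.le
    change |s e (h j)| * l ≤ _
    linarith
  have hsum : ∑ e, ∑ t ∈ T, (Real.exp (l * s e t) + Real.exp (-l * s e t)) ≤ 2 ^ n * M := by
    rw [Finset.sum_comm]
    calc ∑ t ∈ T, ∑ e, (Real.exp (l * s e t) + Real.exp (-l * s e t))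
        ≤ ∑ t ∈ T, 2 * (2 ^ n * Real.exp (l ^ 2 * k / 2)) := by
          refine Finset.sum_le_sum fun t ht => ?_
          rw [Finset.sum_add_distrib, two_mul]
          have hle : Real.exp (l ^ 2 * (∑ i, t i ^ 2) / 2) ≤ Real.exp (l ^ 2 * k / 2) := by
            gcongr
            exact hTk t ht
          refine add_le_add ((sum_sign_exp_le t l).trans ?_) ((sum_sign_exp_le t (-l)).trans ?_)
          · gcongr
          · rw [neg_sq]
            gcongr
      _ = T.card * (2 * (2 ^ n * Real.exp (l ^ 2 * k / 2))) := by simp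
      _ ≤ N * (2 * (2 ^ n * Real.exp (l ^ 2 * k / 2))) := by gcongr
      _ = 2 ^ n * M := by rw [hM]; ring
  have hlogM : Real.log M = Real.log (2 * N) + l ^ 2 * k / 2 := by
    rw [hM, Real.log_mul (by positivity) (Real.exp_ne_zero _), Real.log_exp]
  calc ∑ e : Fin n → Bool, ⨆ j, |∑ i, (if e i then 1 else -1) * h j i| ≤ ∑ e, Q e :=
        Finset.sum_le_sum fun e _ => hpt e
    _ = (2 ^ n * (Real.log M - 1) +
        (∑ e, ∑ t ∈ T, (Real.exp (l * s e t) + Real.exp (-l * s e t))) / M) / l := by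
        rw [hQ, ← Finset.sum_div, Finset.sum_div _ _ M]
        congr 1
        have : ∀ e : Fin n → Bool,
            Real.log M + (∑ t ∈ T, (Real.exp (l * s e t) + Real.exp (-l * s e t))) / M - 1 =
            (Real.log M - 1) + (∑ t ∈ T, (Real.exp (l * s e t) + Real.exp (-l * s e t))) / M :=
          fun e => by ring
        simp_rw [this]
        rw [Finset.sum_add_distrib]
        simp [mul_sub]
    _ ≤ (2 ^ n * (Real.log M - 1) + 2 ^ n) / l := by
        gcongr
        rwa [div_le_iff₀ hMpos]
    _ = 2 ^ n * (Real.log (2 * N) / l + l * k / 2) := by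
        rw [hlogM]
        field_simp
        ring

/-! ### Symmetrization by exchanging pairs inside R. -/

section Symmetrization

variable {α : Type*}

/-- The difference of the indicators of `A` at two points, where only pairs of points of `R` are
taken into account. -/
noncomputable def crossDiff (R A : Set α) (z : α × α) : ℝ :=
  R.indicator 1 z.2 * A.indicator 1 z.1 - R.indicator 1 z.1 * A.indicator 1 z.2

open Classical in
/-- Exchanges two points if both of them are in `R`. -/
noncomputable def swapOn (R : Set α) (z : α × α) : α × α :=
  if z ∈ R ×ˢ R then z.swap else z

/-- Off R × R nothing is exchanged, but there `crossDiff` vanishes because A ⊆ R. -/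
theorem crossDiff_swapOn {R A : Set α} (hA : A ⊆ R) (z : α × α) :
    crossDiff R A (swapOn R z) = -crossDiff R A z := by
  have h1 : z.1 ∉ R → z.1 ∉ A := fun h h' => h (hA h')
  have h2 : z.2 ∉ R → z.2 ∉ A := fun h h' => h (hA h')
  by_cases hz1 : z.1 ∈ R <;> by_cases hz2 : z.2 ∈ R <;>
    simp_all [crossDiff, swapOn]

/-- Summed over the pairs, this bounds squared norms by the hit count instead of n, which is how p
enters the expected deviation. -/
theorem crossDiff_sq_le {R A : Set α} (hA : A ⊆ R) (z : α × α) :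
    crossDiff R A z ^ 2 ≤ R.indicator 1 z.1 := by
  have h1 : z.1 ∉ R → z.1 ∉ A := fun h h' => h (hA h')
  by_cases hz1 : z.1 ∈ R <;> by_cases hz2 : z.2 ∈ R <;> by_cases ha1 : z.1 ∈ A <;>
    by_cases ha2 : z.2 ∈ A <;> simp_all [crossDiff]

theorem abs_crossDiff_le_one {R A : Set α} (hA : A ⊆ R) (z : α × α) : |crossDiff R A z| ≤ 1 := by
  rw [← sq_le_one_iff_abs_le_one]
  refine (crossDiff_sq_le hA z).trans ?_
  by_cases h : z.1 ∈ R <;> simp [h]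

/-- The number of points in `R` among the first components of a sample of pairs. -/
noncomputable def hitCount (R : Set α) {n : ℕ} (x : Fin n → α) : ℝ :=
  ∑ i, R.indicator 1 (x i)

/-- A class of finite VC dimension yields polynomially many vectors of values of `crossDiff` on a
sample of pairs. -/
theorem ncard_range_crossDiff_le {𝒜 ℱ : Set (Set α)} (hV : vcDimension 𝒜 < ⊤) (hℱ : ℱ ⊆ 𝒜)
    {R : Set α} (hR : ∀ A ∈ ℱ, A ⊆ R) {n : ℕ} (z : Fin n → α × α) :
    (Set.range fun (A : ℱ) i => crossDiff R A (z i)).Finite ∧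
      ((Set.range fun (A : ℱ) i => crossDiff R A (z i)).ncard : ℝ) ≤
        (2 * hitCount R (fun i => (z i).1) + 1) ^ (vcDimension 𝒜).toNat := by
  classical
  set J := Finset.univ.filter fun i => (z i).1 ∈ R with hJ
  set s : Finset α := J.biUnion fun i => {(z i).1, (z i).2} with hs
  set 𝒯 := (fun A => (s : Set α) ∩ A) '' 𝒜 with h𝒯
  have h𝒯fin : 𝒯.Finite := s.finite_toSet.finite_subsets.subset (by
    rintro _ ⟨A, -, rfl⟩
    exact Set.inter_subset_left)
  -- Pairs with first point outside R give zero; on the others `crossDiff` depends on A only through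
  -- its trace on `s`, which has at most two points per pair.
  have hsub : (Set.range fun (A : ℱ) i => crossDiff R A (z i)) ⊆
      (fun (u : Set α) i => crossDiff R u (z i)) '' 𝒯 := by
    rintro _ ⟨⟨A, hA⟩, rfl⟩
    refine ⟨_, ⟨A, hℱ hA, rfl⟩, ?_⟩
    funext i
    by_cases hi : (z i).1 ∈ R
    · have h1 : (z i).1 ∈ s := Finset.mem_biUnion.2 ⟨i, by simp [hJ, hi], by simp⟩
      have h2 : (z i).2 ∈ s := Finset.mem_biUnion.2 ⟨i, by simp [hJ, hi], by simp⟩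
      simp [crossDiff, Set.indicator, h1, h2]
    · have : (z i).1 ∉ A := fun h => hi (hR A hA h)
      simp [crossDiff, hi, this]
  have hscard : s.card ≤ 2 * J.card := by
    refine Finset.card_biUnion_le.trans ?_
    rw [mul_comm, ← smul_eq_mul]
    exact Finset.sum_le_card_nsmul _ _ _ fun i _ => Finset.card_le_two
  have hhit : hitCount R (fun i => (z i).1) = J.card := by
    rw [hitCount, hJ, Finset.card_filter]
    push_cast
    refine Finset.sum_congr rfl fun i _ => ?_
    by_cases hi : (z i).1 ∈ R <;> simp [hi]
  refine ⟨(h𝒯fin.image _).subset hsub, ?_⟩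
  rw [hhit]
  have h1 := (Set.ncard_le_ncard hsub (h𝒯fin.image _)).trans (Set.ncard_image_le h𝒯fin)
  have h2 := h1.trans ((ncard_inter_image_le_pow hV s).trans
    (Nat.pow_le_pow_left (Nat.add_le_add_right hscard 1) _))
  exact_mod_cast h2

variable [MeasurableSpace α]

theorem measurable_indicator_one {A : Set α} (hA : MeasurableSet A) :
    Measurable (A.indicator (1 : α → ℝ)) :=
  measurable_one.indicator hA

theorem measurable_crossDiff {R A : Set α} (hR : MeasurableSet R) (hA : MeasurableSet A) :
    Measurable (crossDiff R A) :=
  (((measurable_indicator_one hR).comp measurable_snd).mul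
    ((measurable_indicator_one hA).comp measurable_fst)).sub
    (((measurable_indicator_one hR).comp measurable_fst).mul
    ((measurable_indicator_one hA).comp measurable_snd))

theorem measurable_hitCount {R : Set α} (hR : MeasurableSet R) (n : ℕ) :
    Measurable fun x : Fin n → α => hitCount R x :=
  Finset.measurable_sum _ fun i _ =>
    (measurable_indicator_one hR).comp (measurable_pi_apply i)

theorem measurable_swapOn {R : Set α} (hR : MeasurableSet R) : Measurable (swapOn R) :=
  Measurable.ite (hR.prod hR) measurable_swap measurable_id

/-- Exchanging pairs of points of `R` does not change the law of a pair of independent points with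
laws `μ` and `μ` conditioned on `R`. -/
theorem measurePreserving_swapOn (μ : Measure α) [IsProbabilityMeasure μ] {R : Set α}
    (hR : MeasurableSet R) :
    MeasurePreserving (swapOn R) (μ.prod μ[|R]) (μ.prod μ[|R]) := by
  refine ⟨measurable_swapOn hR, ?_⟩
  -- On R × R the law is a multiple of a symmetric product, hence invariant under exchange; off R ×
  -- R the map is the identity.
  have hres : (μ.prod μ[|R]).restrict (R ×ˢ R) =
      (μ R)⁻¹ • (μ.restrict R).prod (μ.restrict R) := by
    rw [← Measure.prod_restrict, ProbabilityTheory.cond, Measure.restrict_smul,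
      Measure.restrict_restrict hR, Set.inter_self, Measure.prod_smul_right]
  ext B hB
  rw [Measure.map_apply (measurable_swapOn hR) hB]
  have hQ : MeasurableSet (R ×ˢ R) := hR.prod hR
  have hpre : MeasurableSet (swapOn R ⁻¹' B) := measurable_swapOn hR hB
  rw [← measure_inter_add_sdiff (swapOn R ⁻¹' B) hQ, ← measure_inter_add_sdiff B hQ]
  congr 1
  · have h1 : swapOn R ⁻¹' B ∩ R ×ˢ R = Prod.swap ⁻¹' B ∩ R ×ˢ R := by
      ext z
      constructor
      · rintro ⟨h, hz⟩
        refine ⟨?_, hz⟩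
        simpa [swapOn, if_pos hz] using h
      · rintro ⟨h, hz⟩
        refine ⟨?_, hz⟩
        simpa [swapOn, if_pos hz] using h
    rw [h1, ← Measure.restrict_apply (measurable_swap hB), ← Measure.restrict_apply hB, hres,
      Measure.smul_apply, Measure.smul_apply, ← Measure.map_apply measurable_swap hB,
      Measure.prod_swap]
  · congr 1
    ext z
    constructor
    · rintro ⟨h, hz⟩
      refine ⟨?_, hz⟩
      simpa [swapOn, if_neg hz] using h
    · rintro ⟨h, hz⟩
      refine ⟨?_, hz⟩
      simpa [swapOn, if_neg hz] using h

end Symmetrization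

theorem integral_comp_of_measurePreserving {α β : Type*} [MeasurableSpace α] [MeasurableSpace β]
    {μ : Measure α} {ν : Measure β} {f : α → β} (hf : MeasurePreserving f μ ν) {g : β → ℝ}
    (hg : Measurable g) : ∫ x, g (f x) ∂μ = ∫ y, g y ∂ν := by
  rw [← hf.map_eq, integral_map hf.measurable.aemeasurable hg.aestronglyMeasurable]

/-! ### Mean and fluctuations of the number of points in R. -/

section HitCount

variable {α : Type*} [MeasurableSpace α] (μ : Measure α) [IsProbabilityMeasure μ] {R : Set α}

theorem abs_indicator_one_le {α : Type*} (R : Set α) (x : α) :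
    |R.indicator (1 : α → ℝ) x| ≤ 1 := by
  by_cases h : x ∈ R <;> simp [h]

theorem abs_hitCount_le {α : Type*} (R : Set α) {n : ℕ} (x : Fin n → α) : |hitCount R x| ≤ n := by
  refine (Finset.abs_sum_le_sum_abs _ _).trans ?_
  refine (Finset.sum_le_sum fun i _ => abs_indicator_one_le R (x i)).trans ?_
  simp

theorem integral_eval_indicator_one (hR : MeasurableSet R) {n : ℕ} (i : Fin n) :
    ∫ x, R.indicator (1 : α → ℝ) (x i) ∂(Measure.pi fun _ => μ) = μ.real R := by
  rw [integral_comp_of_measurePreserving (measurePreserving_eval (fun _ => μ) i)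
    (measurable_indicator_one hR), integral_indicator_one hR]

theorem integrable_eval_indicator_one (hR : MeasurableSet R) {n : ℕ} (i : Fin n) :
    Integrable (fun x : Fin n → α => R.indicator (1 : α → ℝ) (x i)) (Measure.pi fun _ => μ) :=
  integrable_of_measurable_of_bound
    ((measurable_indicator_one hR).comp (measurable_pi_apply i)) fun _ => abs_indicator_one_le _ _

theorem integral_hitCount (hR : MeasurableSet R) (n : ℕ) :
    ∫ x, hitCount R x ∂(Measure.pi fun _ : Fin n => μ) = n * μ.real R := by
  simp_rw [hitCount]
  rw [integral_finsetSum _ fun i _ => integrable_eval_indicator_one μ hR i]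
  simp_rw [integral_eval_indicator_one μ hR]
  simp

theorem integral_hitCount_sub_sq_le (hR : MeasurableSet R) (n : ℕ) :
    ∫ x, (hitCount R x - n * μ.real R) ^ 2 ∂(Measure.pi fun _ : Fin n => μ) ≤ n * μ.real R := by
  have hmem : MemLp (R.indicator (1 : α → ℝ)) 2 μ :=
    MemLp.of_bound (measurable_indicator_one hR).aestronglyMeasurable 1
      (ae_of_all _ (abs_indicator_one_le R))
  have h := variance_sum_pi (μ := fun _ : Fin n => μ) (X := fun _ => R.indicator (1 : α → ℝ))
    fun _ => hmem
  have hsum : (∑ i : Fin n, fun x : Fin n → α => R.indicator (1 : α → ℝ) (x i)) = hitCount R := by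
    funext x
    simp [hitCount]
  rw [hsum, variance_eq_integral (measurable_hitCount hR n).aemeasurable,
    integral_hitCount μ hR] at h
  rw [h]
  have hvar : Var[R.indicator (1 : α → ℝ); μ] ≤ μ.real R := by
    refine (variance_le_expectation_sq hmem.aestronglyMeasurable).trans_eq ?_
    have : (R.indicator (1 : α → ℝ)) ^ 2 = R.indicator 1 := by
      funext x
      by_cases hx : x ∈ R <;> simp [hx]
    rw [this, integral_indicator_one hR]
  simpa using mul_le_mul_of_nonneg_left hvar (Nat.cast_nonneg n)

/-- Nonnegativity of the variance of |N - np| gives (E|N - np|)² ≤ E(N - np)² ≤ np. -/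
theorem integral_abs_hitCount_sub_le (hR : MeasurableSet R) (n : ℕ) :
    ∫ x, |hitCount R x - n * μ.real R| ∂(Measure.pi fun _ : Fin n => μ) ≤
      Real.sqrt (n * μ.real R) := by
  set Y : (Fin n → α) → ℝ := fun x => |hitCount R x - n * μ.real R| with hY
  have hYm : Measurable Y := ((measurable_hitCount hR n).sub_const _).abs
  have h := variance_nonneg Y (Measure.pi fun _ : Fin n => μ)
  have hmem : MemLp Y 2 (Measure.pi fun _ : Fin n => μ) := by
    refine MemLp.of_bound hYm.aestronglyMeasurable (n + |n * μ.real R|) (ae_of_all _ fun x => ?_)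
    rw [Real.norm_eq_abs, hY, abs_abs]
    exact (abs_sub _ _).trans (add_le_add_left (abs_hitCount_le R x) _)
  rw [variance_eq_sub hmem] at h
  refine Real.le_sqrt_of_sq_le ?_
  have h2 : ∫ x, (Y ^ 2) x ∂(Measure.pi fun _ : Fin n => μ) ≤ n * μ.real R := by
    simp only [hY, Pi.pow_apply, sq_abs]
    exact integral_hitCount_sub_sq_le μ hR n
  linarith

end HitCount

/-! ### The expected maximal deviation. -/

section ExpectedDeviation

variable {α : Type*}

theorem abs_sum_crossDiff_le {R A : Set α} (hA : A ⊆ R) {n : ℕ} (z : Fin n → α × α) :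
    |∑ i, crossDiff R A (z i)| ≤ n := by
  refine (Finset.abs_sum_le_sum_abs _ _).trans ?_
  refine (Finset.sum_le_sum fun i _ => abs_crossDiff_le_one hA (z i)).trans ?_
  simp

/-- The maximal deviation between the two halves of a sample of pairs. -/
noncomputable def symDeviation (R : Set α) (ℱ : Set (Set α)) {n : ℕ} (z : Fin n → α × α) : ℝ :=
  ⨆ A : ℱ, |∑ i, crossDiff R A (z i)|

theorem bddAbove_symDeviation {R : Set α} {ℱ : Set (Set α)} (hℱR : ∀ A ∈ ℱ, A ⊆ R) {n : ℕ}
    (z : Fin n → α × α) :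
    BddAbove (Set.range fun A : ℱ => |∑ i, crossDiff R (A : Set α) (z i)|) :=
  ⟨n, by rintro _ ⟨A, rfl⟩; exact abs_sum_crossDiff_le (hℱR A A.2) z⟩

theorem abs_symDeviation_le {R : Set α} {ℱ : Set (Set α)} (hℱR : ∀ A ∈ ℱ, A ⊆ R) {n : ℕ}
    (z : Fin n → α × α) : |symDeviation R ℱ z| ≤ n := by
  have h0 : 0 ≤ symDeviation R ℱ z := Real.iSup_nonneg fun _ => abs_nonneg _
  rw [abs_of_nonneg h0]
  exact Real.iSup_le (fun A => abs_sum_crossDiff_le (hℱR A A.2) z) (Nat.cast_nonneg n)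

variable [MeasurableSpace α]

theorem measurable_symDeviation {R : Set α} (hR : MeasurableSet R) {ℱ : Set (Set α)}
    (hc : ℱ.Countable) (hm : ∀ A ∈ ℱ, MeasurableSet A) (n : ℕ) :
    Measurable fun z : Fin n → α × α => symDeviation R ℱ z := by
  have : Countable ℱ := hc.to_subtype
  refine Measurable.iSup fun A => ?_
  have := measurable_crossDiff hR (hm A A.2)
  fun_prop

/-- All sign patterns give the same expectation, so it equals its average over signs, to which
Massart's lemma applies for each fixed sample of pairs. The parameter `l` stays free and nonrandom,
to be optimised after integration. -/
theorem integral_symDeviation_le (μ : Measure α) [IsProbabilityMeasure μ] {R : Set α}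
    (hR : MeasurableSet R) (hRpos : 0 < μ.real R) {𝒜 ℱ : Set (Set α)} (hV : vcDimension 𝒜 < ⊤)
    (hℱ : ℱ ⊆ 𝒜) (hne : ℱ.Nonempty) (hc : ℱ.Countable) (hm : ∀ A ∈ ℱ, MeasurableSet A)
    (hℱR : ∀ A ∈ ℱ, A ⊆ R) (n : ℕ) {l : ℝ} (hl : 0 < l) :
    ∫ z, symDeviation R ℱ z ∂(Measure.pi fun _ : Fin n => μ.prod μ[|R]) ≤
      (Real.log 2 + ((vcDimension 𝒜).toNat : ℝ) * Real.log (2 * n * μ.real R + 1)) / l +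
        l * (n * μ.real R) / 2 := by
  have : Nonempty ℱ := hne.to_subtype
  have hμR : μ R ≠ 0 := fun h => by simp [Measure.real, h] at hRpos
  have : IsProbabilityMeasure μ[|R] := cond_isProbabilityMeasure hμR
  set p := μ.real R with hp
  set V : ℝ := ((vcDimension 𝒜).toNat : ℝ) with hVdef
  set Q : Measure (Fin n → α × α) := Measure.pi fun _ => μ.prod μ[|R] with hQ
  set K : (Fin n → α × α) → ℝ := fun z => hitCount R fun i => (z i).1 with hK
  have hfst : MeasurePreserving (fun (z : Fin n → α × α) i => (z i).1) Q
      (Measure.pi fun _ => μ) :=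
    measurePreserving_pi _ _ fun _ => measurePreserving_fst
  have hKm : Measurable K := (measurable_hitCount hR n).comp hfst.measurable
  have hKi : Integrable K Q := integrable_of_measurable_of_bound hKm fun z => abs_hitCount_le R _
  have hKint : ∫ z, K z ∂Q = n * p :=
    (integral_comp_of_measurePreserving hfst (measurable_hitCount hR n)).trans
      (integral_hitCount μ hR n)
  set D : (Fin n → Bool) → (Fin n → α × α) → ℝ := fun e z =>
    ⨆ A : ℱ, |∑ i, (if e i then 1 else -1) * crossDiff R (A : Set α) (z i)| with hD
  -- A sign pattern is realised by exchanging exactly the pairs whose sign is negative.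
  have hflip : ∀ e, ∃ F : (Fin n → α × α) → (Fin n → α × α), MeasurePreserving F Q Q ∧
      ∀ z, symDeviation R ℱ (F z) = D e z := by
    intro e
    refine ⟨fun z i => (if e i then id else swapOn R) (z i),
      measurePreserving_pi _ _ fun i => ?_, fun z => ?_⟩
    · cases e i
      · exact measurePreserving_swapOn μ hR
      · exact MeasurePreserving.id _
    · refine iSup_congr fun A => ?_
      congr 1
      refine Finset.sum_congr rfl fun i _ => ?_
      cases he : e i
      · simp [he, crossDiff_swapOn (hℱR A A.2)]
      · simp [he]
  have hsm := measurable_symDeviation hR hc hm n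
  have hDint : ∀ e, Integrable (D e) Q ∧ ∫ z, D e z ∂Q = ∫ z, symDeviation R ℱ z ∂Q := by
    intro e
    obtain ⟨F, hF, hFD⟩ := hflip e
    have hDe : D e = fun z => symDeviation R ℱ (F z) := funext fun z => (hFD z).symm
    rw [hDe]
    exact ⟨integrable_of_measurable_of_bound (hsm.comp hF.measurable)
      fun z => abs_symDeviation_le hℱR _, integral_comp_of_measurePreserving hF hsm⟩
  have hpt : ∀ z, ∑ e, D e z ≤ 2 ^ n * ((Real.log 2 + V * (Real.log (2 * n * p + 1) +
      (2 * K z - 2 * n * p) / (2 * n * p + 1))) / l + l * K z / 2) := by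
    intro z
    have hK0 : 0 ≤ K z := Finset.sum_nonneg fun i _ => Set.indicator_nonneg (by simp) _
    obtain ⟨hfin, hcard⟩ := ncard_range_crossDiff_le hV hℱ hℱR z
    have h := sum_sign_iSup_abs_le (fun (A : ℱ) i => crossDiff R (A : Set α) (z i)) hfin
      (N := (2 * K z + 1) ^ (vcDimension 𝒜).toNat) (k := K z)
      (one_le_pow₀ (by linarith)) hcard
      (fun A => Finset.sum_le_sum fun i _ => crossDiff_sq_le (hℱR A A.2) (z i)) hl
    refine h.trans ?_
    have hnp : 0 < 2 * n * p + 1 := by positivity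
    -- Tangent to the logarithm at the mean of `K`; the linear correction integrates to zero.
    have hlog : Real.log (2 * K z + 1) ≤ Real.log (2 * n * p + 1) +
        (2 * K z - 2 * n * p) / (2 * n * p + 1) := by
      have h1 := Real.log_le_sub_one_of_pos (x := (2 * K z + 1) / (2 * n * p + 1)) (by positivity)
      rw [Real.log_div (by positivity) hnp.ne'] at h1
      have h2 : (2 * K z + 1) / (2 * n * p + 1) - 1 =
          (2 * K z - 2 * n * p) / (2 * n * p + 1) := by
        field_simp
        ring
      linarith
    rw [Real.log_mul (by norm_num) (by positivity), Real.log_pow]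
    gcongr
  have hBi : Integrable (fun z => 2 ^ n * ((Real.log 2 + V * (Real.log (2 * n * p + 1) +
      (2 * K z - 2 * n * p) / (2 * n * p + 1))) / l + l * K z / 2)) Q := by
    fun_prop
  have hBint : ∫ z, 2 ^ n * ((Real.log 2 + V * (Real.log (2 * n * p + 1) +
      (2 * K z - 2 * n * p) / (2 * n * p + 1))) / l + l * K z / 2) ∂Q =
      2 ^ n * ((Real.log 2 + V * Real.log (2 * n * p + 1)) / l + l * (n * p) / 2) := by
    have hlin : ∀ z, 2 ^ n * ((Real.log 2 + V * (Real.log (2 * n * p + 1) +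
        (2 * K z - 2 * n * p) / (2 * n * p + 1))) / l + l * K z / 2) =
        2 ^ n * ((Real.log 2 + V * Real.log (2 * n * p + 1)) / l + l * (n * p) / 2) +
        2 ^ n * (V * (2 / (2 * n * p + 1)) / l + l / 2) * (K z - n * p) := by
      intro z
      ring
    simp_rw [hlin]
    have hdi : Integrable (fun z => 2 ^ n * (V * (2 / (2 * n * p + 1)) / l + l / 2) *
        (K z - n * p)) Q := (hKi.sub (integrable_const _)).const_mul _
    have hzero : ∫ z, (K z - n * p) ∂Q = 0 := by
      rw [integral_sub hKi (integrable_const _), hKint]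
      simp
    rw [integral_add (integrable_const _) hdi, integral_const,
      integral_const_mul _ fun z => K z - n * p, hzero]
    simp
  have hsum : ∫ z, ∑ e, D e z ∂Q = 2 ^ n * ∫ z, symDeviation R ℱ z ∂Q := by
    rw [integral_finsetSum _ fun e _ => (hDint e).1]
    simp_rw [fun e => (hDint e).2]
    simp
  have hle : ∫ z, ∑ e, D e z ∂Q ≤ _ :=
    integral_mono (integrable_finsetSum _ fun e _ => (hDint e).1) hBi hpt
  rw [hsum, hBint] at hle
  exact le_of_mul_le_mul_left hle (by positivity)

/-- Symmetrization with a ghost sample whose law is `μ` conditioned on `R`. -/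
theorem integral_maxDeviation_le_symDeviation (μ : Measure α) [IsProbabilityMeasure μ] {R : Set α}
    (hR : MeasurableSet R) (hRpos : 0 < μ.real R) {ℱ : Set (Set α)} (hne : ℱ.Nonempty)
    (hc : ℱ.Countable) (hm : ∀ A ∈ ℱ, MeasurableSet A) (hℱR : ∀ A ∈ ℱ, A ⊆ R) {n : ℕ}
    (hn : 0 < n) :
    n * ∫ x, maxDeviation μ ℱ x ∂(Measure.pi fun _ : Fin n => μ) ≤
      ∫ z, symDeviation R ℱ z ∂(Measure.pi fun _ : Fin n => μ.prod μ[|R]) +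
        Real.sqrt (n * μ.real R) := by
  have : Nonempty ℱ := hne.to_subtype
  have hμR : μ R ≠ 0 := fun h => by simp [Measure.real, h] at hRpos
  have : IsProbabilityMeasure μ[|R] := cond_isProbabilityMeasure hμR
  set p := μ.real R with hp
  set ν := μ[|R] with hν
  have hνR : ν.real R = 1 := by
    rw [hν, Measure.real, cond_apply hR, Set.inter_self,
      ENNReal.inv_mul_cancel hμR (measure_ne_top μ R), ENNReal.toReal_one]
  have hνA : ∀ A ∈ ℱ, μ.real A = p * ν.real A := by
    intro A hA
    rw [hν, Measure.real, Measure.real, cond_apply hR, Set.inter_eq_right.2 (hℱR A hA),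
      ENNReal.toReal_mul, ENNReal.toReal_inv]
    exact (mul_inv_cancel_left₀ hRpos.ne' _).symm
  have hn0 : (n : ℝ) ≠ 0 := by positivity
  have hpair : MeasurePreserving
      (fun w : (Fin n → α) × (Fin n → α) => fun i => (w.1 i, w.2 i))
      ((Measure.pi fun _ => μ).prod (Measure.pi fun _ => ν))
      (Measure.pi fun _ => μ.prod ν) :=
    (measurePreserving_arrowProdEquivProdArrow α α (Fin n) (fun _ => μ) (fun _ => ν)).symm
  have hsm := measurable_symDeviation hR hc hm n
  have hsi : Integrable (fun w : (Fin n → α) × (Fin n → α) =>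
      symDeviation R ℱ fun i => (w.1 i, w.2 i))
      ((Measure.pi fun _ => μ).prod (Measure.pi fun _ => ν)) :=
    integrable_of_measurable_of_bound (hsm.comp hpair.measurable)
      fun z => abs_symDeviation_le hℱR _
  set G : (Fin n → α) → ℝ := fun x =>
    ∫ y, symDeviation R ℱ (fun i => (x i, y i)) ∂(Measure.pi fun _ => ν) with hG
  have hpt : ∀ x, n * maxDeviation μ ℱ x ≤ G x + |hitCount R x - n * p| := by
    intro x
    rw [maxDeviation, Real.mul_iSup_of_nonneg (Nat.cast_nonneg n)]
    refine ciSup_le fun A => ?_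
    have hAm := hm A A.2
    have hAR := hℱR A A.2
    have hcm := measurable_crossDiff hR hAm
    have hci : ∀ i, Integrable (fun y : Fin n → α => crossDiff R (A : Set α) (x i, y i))
        (Measure.pi fun _ => ν) := fun i =>
      integrable_of_measurable_of_bound (by fun_prop) fun y => abs_crossDiff_le_one hAR _
    have hci2 : ∀ i, ∫ y, crossDiff R (A : Set α) (x i, y i) ∂(Measure.pi fun _ : Fin n => ν) =
        (A : Set α).indicator 1 (x i) - R.indicator 1 (x i) * ν.real A := by
      intro i
      simp only [crossDiff]
      rw [integral_sub ((integrable_eval_indicator_one ν hR i).mul_const _)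
        ((integrable_eval_indicator_one ν hAm i).const_mul _), integral_mul_const,
        integral_const_mul, integral_eval_indicator_one ν hR, integral_eval_indicator_one ν hAm,
        hνR, one_mul]
    -- Since A ⊆ R, μ(A) = p ν(A), while the ghost average of the cross differences is nμₙ(A) - N
    -- ν(A). The remainder is (N - np) ν(A), with ν(A) ≤ 1.
    have hdecomp : n * ((empiricalMeasure x).real (A : Set α) - μ.real A) =
        ∫ y, ∑ i, crossDiff R (A : Set α) (x i, y i) ∂(Measure.pi fun _ : Fin n => ν) +
          (hitCount R x - n * p) * ν.real A := by
      rw [integral_finsetSum _ fun i _ => hci i]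
      simp_rw [hci2]
      rw [Finset.sum_sub_distrib, ← Finset.sum_mul, empiricalMeasure_real x hAm, hνA A A.2,
        mul_sub, mul_inv_cancel_left₀ hn0, hitCount]
      simp only [Pi.one_def]
      ring
    calc n * |(empiricalMeasure x).real (A : Set α) - μ.real A|
        = |n * ((empiricalMeasure x).real (A : Set α) - μ.real A)| := by
          rw [abs_mul, Nat.abs_cast]
      _ ≤ |∫ y, ∑ i, crossDiff R (A : Set α) (x i, y i) ∂(Measure.pi fun _ : Fin n => ν)| +
          |(hitCount R x - n * p) * ν.real A| := by
          rw [hdecomp]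
          exact abs_add_le _ _
      _ ≤ G x + |hitCount R x - n * p| := by
          refine add_le_add (abs_integral_le_integral_abs.trans ?_) ?_
          · refine integral_mono_of_nonneg (ae_of_all _ fun _ => abs_nonneg _) ?_
              (ae_of_all _ fun y => ?_)
            · exact integrable_of_measurable_of_bound
                (hsm.comp (hpair.measurable.comp measurable_prodMk_left))
                fun z => abs_symDeviation_le hℱR _
            · exact le_ciSup (bddAbove_symDeviation hℱR fun i => (x i, y i)) A
          · rw [abs_mul]
            refine mul_le_of_le_one_right (abs_nonneg _) ?_
            rw [abs_of_nonneg measureReal_nonneg]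
            exact measureReal_le_one
  have hKi : Integrable (fun x : Fin n → α => |hitCount R x - n * p|)
      (Measure.pi fun _ => μ) := by
    have : Integrable (fun x : Fin n → α => hitCount R x) (Measure.pi fun _ => μ) :=
      integrable_of_measurable_of_bound (measurable_hitCount hR n) fun x => abs_hitCount_le R x
    exact (this.sub (integrable_const _)).abs
  rw [← integral_const_mul]
  calc ∫ x, n * maxDeviation μ ℱ x ∂(Measure.pi fun _ : Fin n => μ)
      ≤ ∫ x, (G x + |hitCount R x - n * p|) ∂(Measure.pi fun _ : Fin n => μ) := by
        refine integral_mono_of_nonneg (ae_of_all _ fun x => ?_)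
          (hsi.integral_prod_left.add hKi) (ae_of_all _ hpt)
        exact mul_nonneg (Nat.cast_nonneg n) (Real.iSup_nonneg fun _ => abs_nonneg _)
    _ = ∫ x, G x ∂(Measure.pi fun _ : Fin n => μ) +
        ∫ x, |hitCount R x - n * p| ∂(Measure.pi fun _ : Fin n => μ) :=
        integral_add hsi.integral_prod_left hKi
    _ ≤ ∫ z, symDeviation R ℱ z ∂(Measure.pi fun _ : Fin n => μ.prod ν) +
        Real.sqrt (n * p) := by
        refine add_le_add (le_of_eq ?_) (integral_abs_hitCount_sub_le μ hR n)
        rw [← integral_comp_of_measurePreserving hpair hsm, integral_prod _ hsi]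

/-- A bound for the expected maximal deviation over a class of finite VC dimension whose sets are
contained in `R`. -/
theorem integral_maxDeviation_le (μ : Measure α) [IsProbabilityMeasure μ] {R : Set α}
    (hR : MeasurableSet R) (hRpos : 0 < μ.real R) {𝒜 ℱ : Set (Set α)} (hV : vcDimension 𝒜 < ⊤)
    (hℱ : ℱ ⊆ 𝒜) (hne : ℱ.Nonempty) (hc : ℱ.Countable) (hm : ∀ A ∈ ℱ, MeasurableSet A)
    (hℱR : ∀ A ∈ ℱ, A ⊆ R) {n : ℕ} (hn : 0 < n) :
    ∫ x, maxDeviation μ ℱ x ∂(Measure.pi fun _ : Fin n => μ) ≤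
      Real.sqrt (2 * μ.real R / n) *
        (Real.sqrt (Real.log 2 +
          ((vcDimension 𝒜).toNat : ℝ) * Real.log (2 * n * μ.real R + 1)) + Real.sqrt 2 / 2) := by
  set p := μ.real R with hp
  set H := Real.log 2 + ((vcDimension 𝒜).toNat : ℝ) * Real.log (2 * n * p + 1) with hH
  have hHpos : 0 < H := by
    have h1 : 0 < Real.log 2 := Real.log_pos (by norm_num)
    have h2 : 0 ≤ Real.log (2 * n * p + 1) := by
      refine Real.log_nonneg ?_
      have : 0 ≤ 2 * n * p := by positivity
      linarith
    positivity
  have hnpos : (0 : ℝ) < n := by exact_mod_cast hn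
  set a := Real.sqrt (2 * p / n) with ha
  have ha2 : a ^ 2 = 2 * p / n := Real.sq_sqrt (by positivity)
  have hapos : 0 < a := Real.sqrt_pos.2 (by positivity)
  set b := Real.sqrt H with hb
  have hb2 : b ^ 2 = H := Real.sq_sqrt hHpos.le
  have hbpos : 0 < b := Real.sqrt_pos.2 hHpos
  have hnp : n * p = n ^ 2 * a ^ 2 / 2 := by
    rw [ha2]
    field_simp
  have h1 := integral_maxDeviation_le_symDeviation μ hR hRpos hne hc hm hℱR hn
  -- This is √(2H/(np)), the minimiser of H/l + l·np/2, with minimum √(2Hnp) = n·a·b.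
  have hl : 0 < 2 * b / (n * a) := by positivity
  have h2 := integral_symDeviation_le μ hR hRpos hV hℱ hne hc hm hℱR n hl
  rw [← hp, ← hH, hnp, ← hb2] at h2
  have h3 : b ^ 2 / (2 * b / (n * a)) + 2 * b / (n * a) * (n ^ 2 * a ^ 2 / 2) / 2 =
      n * (a * b) := by
    field_simp
    ring
  have h4 : Real.sqrt (n * p) = n * (a * (Real.sqrt 2 / 2)) := by
    rw [hnp, Real.sqrt_eq_iff_mul_self_eq (by positivity) (by positivity)]
    have : Real.sqrt 2 * Real.sqrt 2 = 2 := Real.mul_self_sqrt (by norm_num)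
    linear_combination (-(n ^ 2 * a ^ 2 / 4) : ℝ) * this
  rw [← hp, h4] at h1
  refine le_of_mul_le_mul_left ?_ hnpos
  rw [h3] at h2
  linarith

end ExpectedDeviation

/-! ### Bounded differences and tail of the maximal deviation. -/

theorem sum_indicator_update_sub {α : Type*} (A : Set α) {n : ℕ} (x : Fin n → α) (i : Fin n)
    (a : α) :
    ∑ j, A.indicator (fun _ => (1 : ℝ)) (Function.update x i a j) -
      ∑ j, A.indicator (fun _ => (1 : ℝ)) (x j) =
      A.indicator (fun _ => (1 : ℝ)) a - A.indicator (fun _ => (1 : ℝ)) (x i) := by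
  rw [← Finset.sum_sub_distrib, Finset.sum_eq_single i]
  · simp
  · intro j _ hj
    simp [Function.update_of_ne hj]
  · simp

theorem maxDeviation_update_eq {α : Type*} [MeasurableSpace α] (μ : Measure α) {R : Set α}
    {ℱ : Set (Set α)} (hm : ∀ A ∈ ℱ, MeasurableSet A) (hℱR : ∀ A ∈ ℱ, A ⊆ R)
    {n : ℕ} (x : Fin n → α) (i : Fin n) (a : α) (ha : a ∉ R) (hx : x i ∉ R) :
    maxDeviation μ ℱ (Function.update x i a) = maxDeviation μ ℱ x := by
  refine iSup_congr fun A => ?_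
  have h1 : a ∉ (A : Set α) := fun h => ha (hℱR A A.2 h)
  have h2 : x i ∉ (A : Set α) := fun h => hx (hℱR A A.2 h)
  have h3 := sum_indicator_update_sub (A : Set α) x i a
  rw [Set.indicator_of_notMem h1, Set.indicator_of_notMem h2, sub_zero, sub_eq_zero] at h3
  rw [empiricalMeasure_real _ (hm A A.2), empiricalMeasure_real _ (hm A A.2), h3]

section Concentration

variable {α : Type*} [MeasurableSpace α] (μ : Measure α) [IsProbabilityMeasure μ] {R : Set α}
  {ℱ : Set (Set α)}

/-- This covers the empty family too, whose real supremum is 0 by convention. -/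
theorem abs_maxDeviation_le_one {n : ℕ} (x : Fin n → α) : |maxDeviation μ ℱ x| ≤ 1 := by
  have h0 : 0 ≤ maxDeviation μ ℱ x := Real.iSup_nonneg fun _ => abs_nonneg _
  rw [abs_of_nonneg h0]
  exact Real.iSup_le (fun A => abs_empiricalMeasure_sub_le_one μ x A) zero_le_one

theorem abs_empiricalMeasure_update_sub_le {A : Set α} (hA : MeasurableSet A) {n : ℕ}
    (x : Fin n → α) (i : Fin n) (a : α) :
    |(empiricalMeasure (Function.update x i a)).real A - (empiricalMeasure x).real A| ≤
      (n : ℝ)⁻¹ := by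
  rw [empiricalMeasure_real _ hA, empiricalMeasure_real _ hA, ← mul_sub,
    sum_indicator_update_sub, abs_mul, abs_of_nonneg (by positivity)]
  refine mul_le_of_le_one_right (by positivity) ?_
  by_cases h1 : a ∈ A <;> by_cases h2 : x i ∈ A <;> simp [h1, h2]

theorem maxDeviation_update_le (hm : ∀ A ∈ ℱ, MeasurableSet A) {n : ℕ} (x : Fin n → α)
    (i : Fin n) (a : α) :
    maxDeviation μ ℱ (Function.update x i a) ≤ maxDeviation μ ℱ x + (n : ℝ)⁻¹ := by
  have h0 : 0 ≤ maxDeviation μ ℱ x := Real.iSup_nonneg fun _ => abs_nonneg _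
  refine Real.iSup_le (fun A => ?_) (by positivity)
  have h1 := abs_empiricalMeasure_update_sub_le (hm A A.2) x i a
  have h2 : |(empiricalMeasure x).real (A : Set α) - μ.real A| ≤ maxDeviation μ ℱ x :=
    le_ciSup (bddAbove_deviation μ ℱ x) A
  have h3 := abs_sub_le ((empiricalMeasure (Function.update x i a)).real (A : Set α))
    ((empiricalMeasure x).real A) (μ.real A)
  linarith

theorem abs_maxDeviation_update_sub_le (hm : ∀ A ∈ ℱ, MeasurableSet A) {n : ℕ} (x : Fin n → α)
    (i : Fin n) (a : α) :
    |maxDeviation μ ℱ (Function.update x i a) - maxDeviation μ ℱ x| ≤ (n : ℝ)⁻¹ := by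
  have h1 := maxDeviation_update_le μ hm x i a
  have h2 := maxDeviation_update_le μ hm (Function.update x i a) i (x i)
  -- Restoring the old value turns the one-sided bound into the reverse one.
  rw [Function.update_idem, Function.update_eq_self] at h2
  rw [abs_sub_le_iff]
  constructor <;> linarith

theorem measureReal_pi_maxDeviation_gt_le (hR : MeasurableSet R) (hRpos : 0 < μ.real R)
    {𝒜 : Set (Set α)} (hV : vcDimension 𝒜 < ⊤) (hℱ : ℱ ⊆ 𝒜) (hne : ℱ.Nonempty)
    (hc : ℱ.Countable) (hm : ∀ A ∈ ℱ, MeasurableSet A) (hℱR : ∀ A ∈ ℱ, A ⊆ R) {n : ℕ}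
    (hn : 0 < n) {L : ℝ} (hL : 0 < L) :
    (Measure.pi fun _ : Fin n => μ).real {x | 2 / (3 * (n : ℝ)) * L +
      Real.sqrt (2 * μ.real R / n) * (Real.sqrt (2 * L) + Real.sqrt (Real.log 2 +
        ((vcDimension 𝒜).toNat : ℝ) * Real.log (2 * n * μ.real R + 1)) + Real.sqrt 2 / 2) <
      maxDeviation μ ℱ x} ≤ Real.exp (-L) := by
  have hnpos : (0 : ℝ) < n := by exact_mod_cast hn
  refine le_trans (measureReal_mono ?_) (measureReal_pi_bernstein μ hR hRpos (inv_pos.2 hnpos) hn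
    (measurable_maxDeviation μ hc hm n) (abs_maxDeviation_le_one μ)
    (abs_maxDeviation_update_sub_le μ hm) (maxDeviation_update_eq μ hm hℱR) hL)
  intro x hx
  have hE := integral_maxDeviation_le μ hR hRpos hV hℱ hne hc hm hℱR hn
  have h1 : 2 / 3 * (n : ℝ)⁻¹ * L = 2 / (3 * (n : ℝ)) * L := by
    field_simp
  -- Bernstein with c = 1/n gives √(2p/n)·√L; the stated √(2L) leaves a factor √2 to spare.
  have h2 : Real.sqrt (2 * (n * (n : ℝ)⁻¹ ^ 2 * μ.real R) * L) ≤
      Real.sqrt (2 * μ.real R / n) * Real.sqrt (2 * L) := by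
    rw [← Real.sqrt_mul (by positivity)]
    refine Real.sqrt_le_sqrt ?_
    have : 2 * (n * (n : ℝ)⁻¹ ^ 2 * μ.real R) * L = 2 * μ.real R / n * L := by
      field_simp
    rw [this]
    gcongr
    linarith
  simp only [Set.mem_ofPred_eq] at hx ⊢
  rw [h1]
  linarith

/-- This handles p = 0, where conditioning on R is meaningless: almost surely no sample point falls
in R. -/
theorem ae_maxDeviation_eq_zero (hR0 : μ.real R = 0)
    (hm : ∀ A ∈ ℱ, MeasurableSet A) (hℱR : ∀ A ∈ ℱ, A ⊆ R) (n : ℕ) :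
    ∀ᵐ x ∂(Measure.pi fun _ : Fin n => μ), maxDeviation μ ℱ x = 0 := by
  have hnull : ∀ᵐ a ∂μ, a ∉ R := by
    rw [← measure_eq_zero_iff_ae_notMem]
    exact (measureReal_eq_zero_iff).1 hR0
  have hall : ∀ᵐ x ∂(Measure.pi fun _ : Fin n => μ), ∀ i, x i ∉ R :=
    ae_all_iff.2 fun i => (measurePreserving_eval (fun _ => μ) i).quasiMeasurePreserving.ae hnull
  filter_upwards [hall] with x hx
  have hzero : ∀ A : ℱ, |(empiricalMeasure x).real (A : Set α) - μ.real A| = 0 := by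
    intro A
    have h1 : μ.real (A : Set α) = 0 :=
      le_antisymm ((measureReal_mono (hℱR A A.2)).trans_eq hR0) measureReal_nonneg
    have h2 : ∀ i, (A : Set α).indicator (fun _ => (1 : ℝ)) (x i) = 0 := fun i =>
      Set.indicator_of_notMem (fun h => hx i (hℱR A A.2 h)) _
    rw [empiricalMeasure_real x (hm A A.2), h1]
    simp [h2]
  simp [maxDeviation, hzero]

end Concentration

/-! ### Transfer to the random sample. -/

theorem mainTheorem1 {Ω : Type*} [MeasurableSpace Ω] (P : Measure Ω) [IsProbabilityMeasure P]
    (d n : ℕ) (hn : 1 ≤ n)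
    (μ : Measure (EuclideanSpace ℝ (Fin d))) [IsProbabilityMeasure μ]
    (X : Fin n → Ω → EuclideanSpace ℝ (Fin d))
    (hX : ∀ i, Measurable (X i)) (hlaw : ∀ i, P.map (X i) = μ) (hindep : iIndepFun X P)
    (𝒜 : Set (Set (EuclideanSpace ℝ (Fin d)))) (hne : 𝒜.Nonempty)
    (hBorel : ∀ A ∈ 𝒜, MeasurableSet A) (hpm : PointwiseMeasurable 𝒜)
    (R : Set (EuclideanSpace ℝ (Fin d))) (hR : MeasurableSet R) (hsub : ∀ A ∈ 𝒜, A ⊆ R)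
    (p : ℝ) (hp : p = μ.real R)
    (hV : vcDimension 𝒜 < ⊤)
    (δ : ℝ) (hδ0 : 0 < δ) (hδ1 : δ < 1) :
    1 - δ ≤ P.real {ω | maxDeviation μ 𝒜 (fun i => X i ω) ≤
      2 / (3 * (n : ℝ)) * Real.log (1 / δ) +
        Real.sqrt (2 * p / n) *
          (Real.sqrt (2 * Real.log (1 / δ)) +
            Real.sqrt (Real.log 2 +
              ((vcDimension 𝒜).toNat : ℝ) * Real.log (2 * n * p + 1)) +
            Real.sqrt 2 / 2)} := by
  obtain ⟨ℱ, hℱ, hc, happrox⟩ := hpm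
  have hℱne : ℱ.Nonempty := by
    obtain ⟨A, hA⟩ := hne
    obtain ⟨B, hB, -⟩ := happrox A hA
    exact ⟨B 0, hB 0⟩
  have hm : ∀ A ∈ ℱ, MeasurableSet A := fun A hA => hBorel A (hℱ hA)
  have hℱR : ∀ A ∈ ℱ, A ⊆ R := fun A hA => hsub A (hℱ hA)
  simp_rw [maxDeviation_eq_of_subclass μ hne hBorel hℱ happrox]
  set L := Real.log (1 / δ) with hL
  have hLpos : 0 < L := Real.log_pos (by rwa [lt_div_iff₀ hδ0, one_mul])
  have hexpL : Real.exp (-L) = δ := by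
    rw [hL, one_div, Real.log_inv, neg_neg, Real.exp_log hδ0]
  set r := 2 / (3 * (n : ℝ)) * L + Real.sqrt (2 * p / n) * (Real.sqrt (2 * L) +
    Real.sqrt (Real.log 2 + ((vcDimension 𝒜).toNat : ℝ) * Real.log (2 * n * p + 1)) +
      Real.sqrt 2 / 2) with hr
  have hXm : Measurable fun ω i => X i ω := measurable_pi_iff.2 hX
  -- Independence and the common law make the joint law a product, so the tail bound on product
  -- space transfers.
  have hmap : P.map (fun ω i => X i ω) = Measure.pi fun _ => μ := by
    rw [(iIndepFun_iff_map_fun_eq_pi_map fun i => (hX i).aemeasurable).1 hindep]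
    simp_rw [hlaw]
  have hset : MeasurableSet {x : Fin n → EuclideanSpace ℝ (Fin d) | maxDeviation μ ℱ x ≤ r} :=
    measurableSet_le (measurable_maxDeviation μ hc hm n) measurable_const
  have htail : (Measure.pi fun _ : Fin n => μ).real {x | maxDeviation μ ℱ x ≤ r}ᶜ ≤ δ := by
    have hcompl : {x : Fin n → EuclideanSpace ℝ (Fin d) | maxDeviation μ ℱ x ≤ r}ᶜ =
        {x | r < maxDeviation μ ℱ x} := by
      ext x
      simp
    rw [hcompl]
    rcases (measureReal_nonneg (μ := μ) (s := R)).eq_or_lt with h0 | h0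
    · have hr0 : 0 ≤ r := by positivity
      have hz : (Measure.pi fun _ : Fin n => μ) {x | r < maxDeviation μ ℱ x} = 0 := by
        rw [measure_eq_zero_iff_ae_notMem]
        filter_upwards [ae_maxDeviation_eq_zero μ h0.symm hm hℱR n] with x hx
        simp [hx, hr0]
      rw [Measure.real, hz, ENNReal.toReal_zero]
      exact hδ0.le
    · rw [hr, hp, ← hexpL]
      exact measureReal_pi_maxDeviation_gt_le μ hR h0 hV hℱ hℱne hc hm hℱR hn hLpos
  have hpre : P.real {ω | maxDeviation μ ℱ (fun i => X i ω) ≤ r} =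
      (Measure.pi fun _ : Fin n => μ).real {x | maxDeviation μ ℱ x ≤ r} := by
    rw [← hmap, map_measureReal_apply hXm hset]
    rfl
  rw [hpre]
  have h1 := probReal_compl_eq_one_sub (μ := Measure.pi fun _ : Fin n => μ) hset
  linarith
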